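/- Conventions. A band is a semigroup in which every element is idempotent. For elements of a band $B$ write $x\leq y$ if $x=yx=xy$ (a partial order) and $x\preceq y$ if $x=xyx$ (a preorder); let $\mathcal{D}$ be the symmetric part of $\preceq$, and order the quotient $B/\mathcal{D}$ (the universal semilattice quotient of $B$) by $[x]\leq[y]\iff x\preceq y$. A zero element is a bottom element of $(B,\leq)$; a global element is an element whose class is a top element of $B/\mathcal{D}$. A right distributive band is a band $B$ that is right regular ($xyx=yx$) and normal ($zxyz=zyxz$), has a zero element, in which any two commuting elements have a supremum for $\leq$, and for which $B/\mathcal{D}$ is a bounded distributive lattice. A map of right distributive bands is a semigroup homomorphism preserving the zero element, global elements and suprema of commuting pairs. A spectral space is a sober space whose compact open subsets are closed under finite intersections (including the empty one) and form a basis of the topology; a spectral map is a continuous map under which preimages of compact open sets are compact. A global spectral sheaf is a pair $(X,F)$ of a spectral space $X$ and a sheaf of sets $F$ on $X$ with $F(X)\neq\emptyset$; a map $(X,F)\to(Y,G)$ is a pair $(f,\varphi)$ of a spectral map $f:X\to Y$ and maps $\varphi_U:G(U)\to F(f^{-1}(U))$, for all open $U\subseteq Y$, compatible with restrictions. Theorem.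 The category of global spectral sheaves is dually equivalent to the category of right distributive bands. More precisely, the contravariant functor which sends $(X,F)$ to the set of pairs $(U,s)$ with $U\subseteq X$ compact open and $s\in F(U)$, with the multiplication $(U,s)(V,t)=(U\cap V,\,t|_{U\cap V})$, and which sends a map $(f,\varphi):(X,F)\to(Y,G)$ to $(U,s)\mapsto(f^{-1}(U),\varphi_U(s))$, is well defined and is a dual equivalence of categories. This extends classical Stone duality: the contravariant functor sending a spectral space to its bounded distributive lattice of compact open subsets, and a spectral map to the preimage map, is a dual equivalence between spectral spaces with spectral maps and bounded distributive lattices with bounded lattice homomorphisms; sending a spectral space to its terminal sheaf (all of whose sets of sections are singletons) and regarding a bounded distributive lattice as a band under meet are fully faithful functors; and, under these two embeddings, the first duality restricts, up to natural isomorphism, to the second. -/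

import Mathlib

open CategoryTheory TopologicalSpace Opposite

universe u

namespace BandDuality

/-! ### Bands -/

/-- A band is an idempotent semigroup. -/
class Band (X : Type u) extends Semigroup X where
  mul_self : ∀ x : X, x * x = x

section Band

variable {X : Type u} [Band X]

/-- The natural order of a band: `x ≤ y` iff `x = yx = xy`. -/
def NatLE (x y : X) : Prop := x = y * x ∧ x = x * y

/-- The preorder `x ≼ y` of a band: `x = xyx`. -/
def PreLE (x y : X) : Prop := x = x * y * x

/-- `o` is a zero element: the bottom element for the natural order. -/
def IsZero (o : X) : Prop := ∀ x : X, NatLE o x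

/-- `s` is the supremum of `x` and `y` for the natural order. -/
def IsSup (x y s : X) : Prop :=
  NatLE x s ∧ NatLE y s ∧ ∀ t : X, NatLE x t → NatLE y t → NatLE s t

theorem PreLE.refl (x : X) : PreLE x x := by
  simp [PreLE, Band.mul_self]

theorem preLE_of_eq {x s z t : X} (h : x = s * z * t) : PreLE x z := by
  have h1 : x * (z * t) = x := by
    conv_lhs => rw [h]
    rw [mul_assoc s z t, mul_assoc, Band.mul_self, ← mul_assoc, ← h]
  have h2 : x * z * x = x := by
    conv_lhs => rw [← h1]
    calc x * (z * t) * z * (x * (z * t))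
        = x * z * t * z * x * (z * t) := by simp only [mul_assoc]
      _ = x * z * x * (z * t) := by
          have : x * z * t = x := by rw [mul_assoc, h1]
          rw [this]
      _ = x * z * x * z * t := by simp only [mul_assoc]
      _ = x * z * t := by
          have : x * z * x * z = x * z := by
            rw [mul_assoc (x * z) x z, Band.mul_self]
          rw [this]
      _ = x := by rw [mul_assoc, h1]
  exact h2.symm

theorem PreLE.trans {x y z : X} (h1 : PreLE x y) (h2 : PreLE y z) : PreLE x z := by
  apply preLE_of_eq (s := x * y) (t := y * x)
  calc x = x * y * x := h1
    _ = x * (y * z * y) * x := by rw [← (show y = y * z * y from h2)]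
    _ = x * y * z * (y * x) := by simp only [mul_assoc]

variable (X) in
/-- Green's relation `𝒟` of a band, the symmetric part of `≼`. -/
def greenD : Setoid X where
  r x y := PreLE x y ∧ PreLE y x
  iseqv :=
    { refl := fun x => ⟨PreLE.refl x, PreLE.refl x⟩
      symm := fun h => ⟨h.2, h.1⟩
      trans := fun h k => ⟨h.1.trans k.1, k.2.trans h.2⟩ }

variable (X) in
/-- The semilattice reflection `X/𝒟` of a band. -/
def Reflection : Type u := Quotient (greenD X)

/-- The class of an element in `X/𝒟`. -/
def toReflection (x : X) : Reflection X := Quotient.mk (greenD X) x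

/-- The semilattice order of `X/𝒟`: `[x] ≤ [y]` iff `x ≼ y`. -/
instance : PartialOrder (Reflection X) where
  le := Quotient.lift₂ (s₁ := greenD X) (s₂ := greenD X) PreLE fun _ _ _ _ h k =>
    propext ⟨fun e => (h.2.trans e).trans k.1, fun e => (h.1.trans e).trans k.2⟩
  le_refl := by
    rintro ⟨x⟩
    exact PreLE.refl x
  le_trans := by
    rintro ⟨x⟩ ⟨y⟩ ⟨z⟩ h k
    exact PreLE.trans (X := X) h k
  le_antisymm := by
    rintro ⟨x⟩ ⟨y⟩ h k
    exact Quotient.sound (s := greenD X) ⟨h, k⟩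

theorem toReflection_le {x y : X} : toReflection x ≤ toReflection y ↔ PreLE x y := Iff.rfl

/-- `x` is a global element: its class is a top element of `X/𝒟`. -/
def IsGlobal (x : X) : Prop := IsTop (toReflection x)

variable (X) in
/-- A right distributive band: a normal, right regular band with zero, in which commuting
elements have a supremum and whose semilattice reflection is a bounded distributive lattice. -/
structure IsRightDistributive : Prop where
  right_regular : ∀ x y : X, x * y * x = y * x
  normal : ∀ x y z : X, z * x * y * z = z * y * x * z
  exists_zero : ∃ o : X, IsZero o
  exists_sup : ∀ x y : X, x * y = y * x → ∃ s : X, IsSup x y s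
  reflection : ∃ (L : Type u) (_ : DistribLattice L) (_ : BoundedOrder L),
    Nonempty (Reflection X ≃o L)

end Band

/-- A bundled right distributive band. -/
structure RightDistBand : Type (u + 1) where
  carrier : Type u
  [band : Band carrier]
  isRightDistributive : IsRightDistributive carrier

attribute [instance] RightDistBand.band

/-- A map of distributive bands: a homomorphism of semigroups preserving the zero element,
global elements and suprema of commuting elements. -/
@[ext]
structure RightDistBand.Hom (X Y : RightDistBand.{u}) where
  toFun : X.carrier → Y.carrier
  map_mul : ∀ x y, toFun (x * y) = toFun x * toFun y
  map_zero : ∀ o, IsZero o → IsZero (toFun o)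
  map_global : ∀ x, IsGlobal x → IsGlobal (toFun x)
  map_sup : ∀ x y s, x * y = y * x → IsSup x y s → IsSup (toFun x) (toFun y) (toFun s)

/-- The category of right distributive bands. -/
instance : Category RightDistBand.{u} where
  Hom := RightDistBand.Hom
  id X :=
    { toFun := fun x => x
      map_mul := fun _ _ => rfl
      map_zero := fun _ h => h
      map_global := fun _ h => h
      map_sup := fun _ _ _ _ h => h }
  comp f g :=
    { toFun := fun x => g.toFun (f.toFun x)
      map_mul := fun x y => by rw [f.map_mul, g.map_mul]
      map_zero := fun o h => g.map_zero _ (f.map_zero o h)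
      map_global := fun x h => g.map_global _ (f.map_global x h)
      map_sup := fun x y s c h =>
        g.map_sup _ _ _ (by rw [← f.map_mul, ← f.map_mul, c]) (f.map_sup x y s c h) }

/-! ### Spectral spaces -/

/-- A bundled spectral space. -/
structure SpectralTop : Type (u + 1) where
  carrier : Type u
  [top : TopologicalSpace carrier]
  [spectral : SpectralSpace carrier]

attribute [instance] SpectralTop.top SpectralTop.spectral

/-- The category of spectral spaces and spectral maps. -/
instance : Category SpectralTop.{u} where
  Hom X Y := SpectralMap X.carrier Y.carrier
  id X := SpectralMap.id X.carrier
  comp f g := SpectralMap.comp g f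

/-- The preimage of an open set under a spectral map. -/
def preimage {X Y : Type u} [TopologicalSpace X] [TopologicalSpace Y]
    (f : SpectralMap X Y) (U : Opens Y) : Opens X :=
  ⟨f ⁻¹' (U : Set Y), U.isOpen.preimage f.spectral'.continuous⟩

theorem preimage_mono {X Y : Type u} [TopologicalSpace X] [TopologicalSpace Y]
    (f : SpectralMap X Y) {U V : Opens Y} (h : V ≤ U) : preimage f V ≤ preimage f U :=
  fun _ hx => h hx

/-- The preimage of a compact open set under a spectral map. -/
def preimageKO {X Y : Type u} [TopologicalSpace X] [TopologicalSpace Y]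
    (f : SpectralMap X Y) (U : CompactOpens Y) : CompactOpens X :=
  ⟨⟨f ⁻¹' (U : Set Y), U.isCompact.preimage_of_isOpen f.spectral' U.isOpen⟩,
    U.isOpen.preimage f.spectral'.continuous⟩

/-- The compact open subsets of a quasi-separated space form a distributive lattice. -/
instance {X : Type u} [TopologicalSpace X] [QuasiSeparatedSpace X] :
    DistribLattice (CompactOpens X) :=
  { (inferInstance : SemilatticeSup (CompactOpens X)),
    (inferInstance : SemilatticeInf (CompactOpens X)) with
    le_sup_inf := fun a b c => by
      intro x hx
      have h1 : (x ∈ a ∨ x ∈ b) ∧ (x ∈ a ∨ x ∈ c) := hx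
      have h2 : x ∈ a ∨ (x ∈ b ∧ x ∈ c) := by tauto
      exact h2 }

/-- The functor sending a spectral space to its bounded distributive lattice of compact open
subsets, and a spectral map to the preimage map. -/
def KO : SpectralTop.{u}ᵒᵖ ⥤ BddDistLat.{u} where
  obj X := BddDistLat.of (CompactOpens X.unop.carrier)
  map {X Y} f := BddDistLat.ofHom
    { toFun := preimageKO (X := Y.unop.carrier) (Y := X.unop.carrier) f.unop
      map_sup' := fun _ _ => rfl
      map_inf' := fun _ _ => rfl
      map_top' := rfl
      map_bot' := rfl }

/-! ### Global spectral sheaves -/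

/-- A set-valued sheaf with a global section on a spectral space. -/
structure GlobalSpectralSheaf : Type (u + 1) where
  space : SpectralTop.{u}
  sheaf : TopCat.Sheaf (Type u) (TopCat.of space.carrier)
  exists_global : Nonempty (sheaf.obj.obj (op ⊤))

namespace GlobalSpectralSheaf

/-- The set of sections over an open subset. -/
abbrev Sections (F : GlobalSpectralSheaf.{u}) (U : Opens F.space.carrier) : Type u :=
  F.sheaf.obj.obj (op U)

/-- Restriction of sections. -/
def res (F : GlobalSpectralSheaf.{u}) {U V : Opens F.space.carrier} (h : V ≤ U)
    (s : F.Sections U) : F.Sections V :=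
  F.sheaf.obj.map (homOfLE h).op s

theorem res_self (F : GlobalSpectralSheaf.{u}) {U : Opens F.space.carrier} (h : U ≤ U)
    (s : F.Sections U) : F.res h s = s :=
  ConcreteCategory.congr_hom (F.sheaf.obj.map_id (op U)) s

theorem res_res (F : GlobalSpectralSheaf.{u}) {U V W : Opens F.space.carrier} (h : V ≤ U)
    (k : W ≤ V) (s : F.Sections U) : F.res k (F.res h s) = F.res (k.trans h) s :=
  (ConcreteCategory.congr_hom
    (F.sheaf.obj.map_comp (homOfLE h).op (homOfLE k).op) s).symm

/-- A map `(X, F) → (Y, G)`: a spectral map `f : X → Y` together with maps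
`G(U) → F(f⁻¹(U))`, one for each open subset `U` of `Y`, compatible with restrictions. -/
@[ext]
structure Hom (F G : GlobalSpectralSheaf.{u}) where
  base : SpectralMap F.space.carrier G.space.carrier
  app : ∀ U : Opens G.space.carrier, G.Sections U → F.Sections (preimage base U)
  naturality : ∀ {U V : Opens G.space.carrier} (h : V ≤ U) (s : G.Sections U),
    app V (G.res h s) = F.res (preimage_mono base h) (app U s)

/-- The category of global spectral sheaves. -/
instance : Category GlobalSpectralSheaf.{u} where
  Hom := Hom
  id F :=
    { base := SpectralMap.id _
      app := fun _ s => s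
      naturality := fun _ _ => rfl }
  comp {F G H} f g :=
    { base := SpectralMap.comp g.base f.base
      app := fun U s => f.app (preimage g.base U) (g.app U s)
      naturality := fun h s => by
        rw [g.naturality, f.naturality]
        rfl }

end GlobalSpectralSheaf

/-- The functor sending a spectral space to its terminal sheaf, the sheaf all of whose sets of
sections are singletons. -/
def terminalSheaf : SpectralTop.{u} ⥤ GlobalSpectralSheaf.{u} where
  obj X :=
    { space := X
      sheaf := ⟨(Functor.const _).obj PUnit.{u + 1},
        Presheaf.isSheaf_of_isTerminal _ Limits.Types.isTerminalPUnit⟩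
      exists_global := ⟨PUnit.unit⟩ }
  map {X Y} f :=
    { base := f
      app := fun _ _ => PUnit.unit
      naturality := fun _ _ => rfl }

/-! ### The band of local sections over compact open subsets -/

/-- A local section over a compact open subset. -/
structure LocalSection (F : GlobalSpectralSheaf.{u}) : Type u where
  dom : CompactOpens F.space.carrier
  val : F.Sections dom.toOpens

namespace LocalSection

variable {F G : GlobalSpectralSheaf.{u}}

theorem toOpens_mono {X : Type u} [TopologicalSpace X] {U V : CompactOpens X} (h : U ≤ V) :
    U.toOpens ≤ V.toOpens := h

/-- The restriction of a local section to a smaller compact open subset. -/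
def restrict (a : LocalSection F) (U : CompactOpens F.space.carrier) (h : U ≤ a.dom) :
    LocalSection F :=
  ⟨U, F.res (toOpens_mono h) a.val⟩

theorem restrict_self (a : LocalSection F) (h : a.dom ≤ a.dom) : a.restrict a.dom h = a := by
  cases a
  simp only [restrict, GlobalSpectralSheaf.res_self]

theorem restrict_restrict (a : LocalSection F) {U V : CompactOpens F.space.carrier}
    (h : U ≤ a.dom) (k : V ≤ U) :
    (a.restrict U h).restrict V k = a.restrict V (k.trans h) :=
  congrArg (LocalSection.mk V) (F.res_res (toOpens_mono h) (toOpens_mono k) a.val)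

theorem restrict_congr (a : LocalSection F) {U V : CompactOpens F.space.carrier}
    (e : U = V) (h : U ≤ a.dom) : a.restrict U h = a.restrict V (e ▸ h) := by
  subst e
  rfl

/-- The band of local sections: `(U, s)(V, t) = (U ∩ V, t|_{U ∩ V})`. -/
instance : Mul (LocalSection F) where
  mul a b := b.restrict (a.dom ⊓ b.dom) inf_le_right

theorem mul_def (a b : LocalSection F) : a * b = b.restrict (a.dom ⊓ b.dom) inf_le_right := rfl

@[simp]
theorem dom_mul (a b : LocalSection F) : (a * b).dom = a.dom ⊓ b.dom := rfl

@[simp]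
theorem dom_restrict (a : LocalSection F) (U : CompactOpens F.space.carrier) (h : U ≤ a.dom) :
    (a.restrict U h).dom = U := rfl

instance : Band (LocalSection F) where
  mul_assoc a b c := by
    have h1 : a * b * c = c.restrict (a.dom ⊓ b.dom ⊓ c.dom) inf_le_right := rfl
    have h2 : a * (b * c) = (c.restrict (b.dom ⊓ c.dom) inf_le_right).restrict
        (a.dom ⊓ (b.dom ⊓ c.dom)) inf_le_right := rfl
    rw [h1, h2, restrict_restrict, restrict_congr c (inf_assoc a.dom b.dom c.dom)]
  mul_self a := by
    rw [mul_def, restrict_congr a (inf_idem a.dom), restrict_self]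

theorem natLE_iff {a b : LocalSection F} :
    NatLE a b ↔ ∃ h : a.dom ≤ b.dom, a = b.restrict a.dom h := by
  constructor
  · rintro ⟨-, h2⟩
    have hd : a.dom = a.dom ⊓ b.dom := congrArg LocalSection.dom h2
    have hle : a.dom ≤ b.dom := inf_eq_left.mp hd.symm
    refine ⟨hle, ?_⟩
    rw [restrict_congr b hd hle]
    exact h2
  · rintro ⟨h, e⟩
    constructor
    · rw [mul_def, restrict_congr a (inf_eq_right.mpr h), restrict_self]
    · rw [mul_def, restrict_congr b (inf_eq_left.mpr h)]
      exact e

theorem preLE_iff {a b : LocalSection F} : PreLE a b ↔ a.dom ≤ b.dom := by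
  constructor
  · intro h
    have hd : a.dom = a.dom ⊓ b.dom ⊓ a.dom := congrArg LocalSection.dom h
    rw [hd]
    exact inf_le_left.trans inf_le_right
  · intro h
    have hd : a.dom ⊓ b.dom ⊓ a.dom = a.dom := by
      rw [inf_eq_left.mpr h, inf_idem]
    have hm : a * b * a = a.restrict (a.dom ⊓ b.dom ⊓ a.dom) inf_le_right := rfl
    rw [PreLE, hm, restrict_congr a hd, restrict_self]

theorem eq_of_restrict_eq {a b : LocalSection F} {U V : CompactOpens F.space.carrier}
    (hd : a.dom = b.dom) (hU : U ≤ a.dom) (hV : V ≤ a.dom) (hc : a.dom ≤ U ⊔ V)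
    (h1 : a.restrict U hU = b.restrict U (hd ▸ hU))
    (h2 : a.restrict V hV = b.restrict V (hd ▸ hV)) : a = b := by
  obtain ⟨A, s⟩ := a
  obtain ⟨B, t⟩ := b
  obtain rfl : A = B := hd
  have e1 := (LocalSection.mk.inj h1).2
  have e2 := (LocalSection.mk.inj h2).2
  congr 1
  exact F.sheaf.eq_of_locally_eq₂ (U₁ := U.toOpens) (U₂ := V.toOpens) (V := A.toOpens)
    (homOfLE hU) (homOfLE hV) hc s t (eq_of_heq e1) (eq_of_heq e2)

theorem exists_glue {a b : LocalSection F} (h : a * b = b * a) :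
    ∃ s : LocalSection F, s.dom = a.dom ⊔ b.dom ∧ NatLE a s ∧ NatLE b s := by
  have hc := (LocalSection.mk.inj ((mul_def a b).symm.trans (h.trans
    ((mul_def b a).trans (restrict_congr a (inf_comm b.dom a.dom) inf_le_right))))).2
  have hc := eq_of_heq hc
  let U : Bool → Opens F.space.carrier := fun i => if i then a.dom.toOpens else b.dom.toOpens
  let sf : ∀ i : Bool, F.Sections (U i) := fun i => match i with
    | true => a.val
    | false => b.val
  have hU : ∀ i, U i ≤ (a.dom ⊔ b.dom).toOpens := by
    rintro (_ | _)
    · exact fun x hx => Or.inr hx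
    · exact fun x hx => Or.inl hx
  obtain ⟨s, hs, -⟩ := F.sheaf.existsUnique_gluing' U (a.dom ⊔ b.dom).toOpens
    (fun i => homOfLE (hU i)) (by
      rintro x (hx | hx)
      · exact Opens.mem_iSup.mpr ⟨true, hx⟩
      · exact Opens.mem_iSup.mpr ⟨false, hx⟩) sf (by
      rintro (_ | _) (_ | _)
      · rfl
      · have hba : b.dom.toOpens ⊓ a.dom.toOpens ≤ (a.dom ⊓ b.dom).toOpens :=
          fun x hx => ⟨hx.2, hx.1⟩
        have := congrArg (F.res hba) hc
        exact (F.res_res (toOpens_mono inf_le_right) hba b.val).symm.trans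
          (this.trans (F.res_res (toOpens_mono inf_le_left) hba a.val))
      · exact hc.symm
      · rfl)
  refine ⟨⟨a.dom ⊔ b.dom, s⟩, rfl, natLE_iff.mpr ⟨le_sup_left, ?_⟩,
    natLE_iff.mpr ⟨le_sup_right, ?_⟩⟩
  · obtain ⟨A, r⟩ := a
    exact congrArg (LocalSection.mk A) (hs true).symm
  · obtain ⟨B, r⟩ := b
    exact congrArg (LocalSection.mk B) (hs false).symm

theorem isSup_of_dom {a b s : LocalSection F} (hd : s.dom = a.dom ⊔ b.dom)
    (ha : NatLE a s) (hb : NatLE b s) : IsSup a b s := by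
  refine ⟨ha, hb, fun t hat hbt => ?_⟩
  obtain ⟨ha1, ha2⟩ := natLE_iff.mp ha
  obtain ⟨hb1, hb2⟩ := natLE_iff.mp hb
  obtain ⟨hat1, hat2⟩ := natLE_iff.mp hat
  obtain ⟨hbt1, hbt2⟩ := natLE_iff.mp hbt
  have hst : s.dom ≤ t.dom := hd ▸ sup_le hat1 hbt1
  refine natLE_iff.mpr ⟨hst, eq_of_restrict_eq (b := t.restrict s.dom hst) rfl ha1 hb1 hd.le ?_ ?_⟩
  · rw [restrict_restrict, ← ha2]
    exact hat2
  · rw [restrict_restrict, ← hb2]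
    exact hbt2

theorem isSup_iff {a b s : LocalSection F} (h : a * b = b * a) :
    IsSup a b s ↔ s.dom = a.dom ⊔ b.dom ∧ NatLE a s ∧ NatLE b s := by
  constructor
  · intro hs
    refine ⟨le_antisymm ?_ ?_, hs.1, hs.2.1⟩
    · obtain ⟨g, hg, ha, hb⟩ := exists_glue h
      exact hg ▸ (natLE_iff.mp (hs.2.2 g ha hb)).1
    · exact sup_le (natLE_iff.mp hs.1).1 (natLE_iff.mp hs.2.1).1
  · rintro ⟨hd, ha, hb⟩
    exact isSup_of_dom hd ha hb

theorem exists_dom (U : CompactOpens F.space.carrier) : ∃ a : LocalSection F, a.dom = U := by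
  obtain ⟨s⟩ := F.exists_global
  exact ⟨⟨U, F.res (U := ⊤) (V := U.toOpens) le_top s⟩, rfl⟩

theorem eq_bot (b c : LocalSection F) :
    b.restrict ⊥ bot_le = c.restrict ⊥ bot_le := by
  refine congrArg (LocalSection.mk ⊥) ?_
  exact F.sheaf.eq_of_locally_eq' (fun i : PEmpty.{1} => i.elim)
    (⊥ : CompactOpens F.space.carrier).toOpens (fun i => i.elim) (fun x hx => hx.elim) _ _
    (fun i => i.elim)

theorem isZero_iff {a : LocalSection F} : IsZero a ↔ a.dom = ⊥ := by
  constructor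
  · intro h
    obtain ⟨b, hb⟩ := exists_dom (F := F) ⊥
    exact le_bot_iff.mp (hb ▸ (natLE_iff.mp (h b)).1)
  · intro h b
    have hb : a.dom ≤ b.dom := h ▸ bot_le
    refine natLE_iff.mpr ⟨hb, ?_⟩
    exact eq_of_restrict_eq (b := b.restrict a.dom hb) (U := ⊥) (V := ⊥) rfl bot_le bot_le
      (by simp [h]) (eq_bot _ _) (eq_bot _ _)

/-- The semilattice reflection of the band of local sections over compact open subsets is the
lattice of compact open subsets. -/
noncomputable def reflectionIso : Reflection (LocalSection F) ≃o CompactOpens F.space.carrier where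
  toFun := Quotient.lift (s := greenD (LocalSection F)) LocalSection.dom fun _ _ h =>
    le_antisymm (preLE_iff.mp h.1) (preLE_iff.mp h.2)
  invFun U := toReflection (exists_dom U).choose
  left_inv := by
    rintro ⟨a⟩
    have h := (exists_dom (F := F) a.dom).choose_spec
    exact Quotient.sound (s := greenD (LocalSection F)) ⟨preLE_iff.mpr h.le, preLE_iff.mpr h.ge⟩
  right_inv U := (exists_dom U).choose_spec
  map_rel_iff' := by
    rintro ⟨a⟩ ⟨b⟩
    exact preLE_iff.symm

theorem isGlobal_iff {a : LocalSection F} : IsGlobal a ↔ a.dom = ⊤ := by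
  constructor
  · intro h
    obtain ⟨b, hb⟩ := exists_dom (F := F) ⊤
    exact top_le_iff.mp (hb ▸ preLE_iff.mp (h (toReflection b)))
  · rintro h ⟨b⟩
    exact preLE_iff.mpr (h ▸ le_top)

variable (F) in
theorem isRightDistributive : IsRightDistributive (LocalSection F) where
  right_regular a b := by
    have h1 : a * b * a = a.restrict (a.dom ⊓ b.dom ⊓ a.dom) inf_le_right := rfl
    have h2 : b * a = a.restrict (b.dom ⊓ a.dom) inf_le_right := rfl
    have hd : a.dom ⊓ b.dom ⊓ a.dom = b.dom ⊓ a.dom := by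
      rw [inf_comm a.dom b.dom, inf_assoc, inf_idem]
    rw [h1, h2, restrict_congr a hd]
  normal a b c := by
    have h1 : c * a * b * c = c.restrict (c.dom ⊓ a.dom ⊓ b.dom ⊓ c.dom) inf_le_right := rfl
    have h2 : c * b * a * c = c.restrict (c.dom ⊓ b.dom ⊓ a.dom ⊓ c.dom) inf_le_right := rfl
    have hd : c.dom ⊓ a.dom ⊓ b.dom ⊓ c.dom = c.dom ⊓ b.dom ⊓ a.dom ⊓ c.dom := by
      rw [inf_right_comm c.dom a.dom b.dom]
    rw [h1, h2, restrict_congr c hd]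
  exists_zero := by
    obtain ⟨a, ha⟩ := exists_dom (F := F) ⊥
    exact ⟨a, isZero_iff.mpr ha⟩
  exists_sup a b h := by
    obtain ⟨s, hs⟩ := exists_glue h
    exact ⟨s, (isSup_iff h).mpr hs⟩
  reflection := ⟨CompactOpens F.space.carrier, inferInstance, inferInstance, ⟨reflectionIso⟩⟩

/-- The action of a map of sheaves `(f, φ)` on local sections: `(U, s) ↦ (f⁻¹(U), φ_U(s))`. -/
def map (f : F ⟶ G) (a : LocalSection G) : LocalSection F :=
  ⟨preimageKO f.base a.dom, f.app a.dom.toOpens a.val⟩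

theorem preimageKO_mono (f : F ⟶ G) {U V : CompactOpens G.space.carrier} (h : U ≤ V) :
    preimageKO f.base U ≤ preimageKO f.base V := fun _ hx => h hx

theorem map_restrict (f : F ⟶ G) (a : LocalSection G) (U : CompactOpens G.space.carrier)
    (h : U ≤ a.dom) : (a.restrict U h).map f =
      (a.map f).restrict (preimageKO f.base U) (preimageKO_mono f h) :=
  congrArg (LocalSection.mk (preimageKO f.base U)) (f.naturality (toOpens_mono h) a.val)

theorem map_mul (f : F ⟶ G) (a b : LocalSection G) : (a * b).map f = a.map f * b.map f :=
  map_restrict f b (a.dom ⊓ b.dom) inf_le_right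

theorem map_natLE (f : F ⟶ G) {a b : LocalSection G} (h : NatLE a b) :
    NatLE (a.map f) (b.map f) :=
  ⟨(congrArg (map f) h.1).trans (map_mul f b a), (congrArg (map f) h.2).trans (map_mul f a b)⟩

end LocalSection

/-- The functor sending a global sheaf on a spectral space to the right distributive band of its
local sections over compact open subsets. -/
def localSectionBand : GlobalSpectralSheaf.{u}ᵒᵖ ⥤ RightDistBand.{u} where
  obj F :=
    { carrier := LocalSection F.unop
      isRightDistributive := LocalSection.isRightDistributive F.unop }
  map f :=
    { toFun := LocalSection.map f.unop
      map_mul := LocalSection.map_mul f.unop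
      map_zero := fun o h => LocalSection.isZero_iff.mpr
        (congrArg (preimageKO f.unop.base) (LocalSection.isZero_iff.mp h))
      map_global := fun x h => LocalSection.isGlobal_iff.mpr
        (congrArg (preimageKO f.unop.base) (LocalSection.isGlobal_iff.mp h))
      map_sup := fun x y s c h => LocalSection.isSup_of_dom
        (congrArg (preimageKO f.unop.base) ((LocalSection.isSup_iff c).mp h).1)
        (LocalSection.map_natLE f.unop h.1) (LocalSection.map_natLE f.unop h.2.1) }

/-! ### Bounded distributive lattices as commutative bands -/

/-- The underlying set of a lattice, regarded as a band under the meet operation. -/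
structure MeetBand (L : Type u) : Type u where
  val : L

namespace MeetBand

section

variable {L : Type u}

theorem ext_iff' {a b : MeetBand L} : a = b ↔ a.val = b.val := by
  cases a
  cases b
  simp

variable [DistribLattice L]

instance : Band (MeetBand L) where
  mul a b := ⟨a.val ⊓ b.val⟩
  mul_assoc a b c := congrArg MeetBand.mk (inf_assoc a.val b.val c.val)
  mul_self a := congrArg MeetBand.mk (inf_idem a.val)

theorem val_mul (a b : MeetBand L) : (a * b).val = a.val ⊓ b.val := rfl

theorem natLE_iff {a b : MeetBand L} : NatLE a b ↔ a.val ≤ b.val := by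
  simp only [NatLE, ext_iff', val_mul, eq_comm (a := a.val), inf_eq_right, inf_eq_left, and_self]

theorem preLE_iff {a b : MeetBand L} : PreLE a b ↔ a.val ≤ b.val := by
  simp only [PreLE, ext_iff', val_mul]
  rw [inf_comm a.val b.val, inf_assoc, inf_idem, eq_comm, inf_eq_right]

theorem isSup_iff {a b s : MeetBand L} : IsSup a b s ↔ s.val = a.val ⊔ b.val := by
  simp only [IsSup, natLE_iff]
  constructor
  · rintro ⟨h1, h2, h3⟩
    exact le_antisymm (h3 ⟨a.val ⊔ b.val⟩ le_sup_left le_sup_right) (sup_le h1 h2)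
  · intro h
    exact ⟨h ▸ le_sup_left, h ▸ le_sup_right, fun t h1 h2 => h ▸ sup_le h1 h2⟩

variable [BoundedOrder L]

theorem isZero_iff {a : MeetBand L} : IsZero a ↔ a.val = ⊥ :=
  ⟨fun h => le_bot_iff.mp (natLE_iff.mp (h ⟨⊥⟩)), fun h _ => natLE_iff.mpr (h ▸ bot_le)⟩

theorem isGlobal_iff {a : MeetBand L} : IsGlobal a ↔ a.val = ⊤ := by
  constructor
  · intro h
    exact top_le_iff.mp (preLE_iff.mp (h (toReflection ⟨⊤⟩)))
  · rintro h ⟨b⟩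
    exact preLE_iff.mpr (h ▸ le_top)

/-- The semilattice reflection of a commutative band is the band itself. -/
def reflectionIso : Reflection (MeetBand L) ≃o L where
  toFun := Quotient.lift (s := greenD (MeetBand L)) MeetBand.val fun _ _ h =>
    le_antisymm (preLE_iff.mp h.1) (preLE_iff.mp h.2)
  invFun a := toReflection ⟨a⟩
  left_inv := by
    rintro ⟨a⟩
    rfl
  right_inv _ := rfl
  map_rel_iff' := by
    rintro ⟨a⟩ ⟨b⟩
    exact preLE_iff.symm

variable (L) in
theorem isRightDistributive : IsRightDistributive (MeetBand L) where
  right_regular a b := by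
    simp only [ext_iff', val_mul]
    rw [inf_comm a.val b.val, inf_assoc, inf_idem]
  normal a b c := by
    simp only [ext_iff', val_mul]
    rw [inf_right_comm c.val a.val b.val]
  exists_zero := ⟨⟨⊥⟩, isZero_iff.mpr rfl⟩
  exists_sup a b _ := ⟨⟨a.val ⊔ b.val⟩, isSup_iff.mpr rfl⟩
  reflection := ⟨L, inferInstance, inferInstance, ⟨reflectionIso⟩⟩

end

end MeetBand

/-- The functor regarding a bounded distributive lattice as a commutative right distributive
band under the meet operation. -/
def latticeBand : BddDistLat.{u} ⥤ RightDistBand.{u} where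
  obj L :=
    { carrier := MeetBand L
      isRightDistributive := MeetBand.isRightDistributive L }
  map {L M} f :=
    { toFun := fun a => ⟨f.hom a.val⟩
      map_mul := fun a b => congrArg MeetBand.mk (InfHomClass.map_inf f.hom a.val b.val)
      map_zero := fun o h => MeetBand.isZero_iff.mpr
        ((congrArg f.hom (MeetBand.isZero_iff.mp h)).trans (BotHomClass.map_bot f.hom))
      map_global := fun x h => MeetBand.isGlobal_iff.mpr
        ((congrArg f.hom (MeetBand.isGlobal_iff.mp h)).trans (TopHomClass.map_top f.hom))
      map_sup := fun x y s _ h => MeetBand.isSup_iff.mpr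
        ((congrArg f.hom (MeetBand.isSup_iff.mp h)).trans (SupHomClass.map_sup f.hom x.val y.val)) }

end BandDuality

namespace BandDuality

/-! ### Compact open subsets -/

section CompactOpens

variable {X : Type u} [TopologicalSpace X]

theorem exists_compactOpens_le [PrespectralSpace X] {U : Opens X} {x : X} (hx : x ∈ U) :
    ∃ K : CompactOpens X, x ∈ K ∧ K.toOpens ≤ U := by
  obtain ⟨V, ⟨h₁, h₂⟩, hxV, hVU⟩ :=
    PrespectralSpace.isTopologicalBasis.exists_subset_of_mem_open (show x ∈ (U : Set X) from hx) U.2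
  exact ⟨⟨⟨V, h₂⟩, h₁⟩, hxV, hVU⟩

/-- A property of compact open sets that holds locally and is stable under finite unions holds. -/
theorem compactOpens_induction {P : CompactOpens X → Prop} (K : CompactOpens X) (hbot : P ⊥)
    (hsup : ∀ U V, P U → P V → P (U ⊔ V))
    (hloc : ∀ x ∈ K, ∃ U : CompactOpens X, U ≤ K ∧ x ∈ U ∧ P U) : P K := by
  choose! U hUK hxU hPU using hloc
  obtain ⟨t, ht, hK⟩ := K.isCompact.elim_nhds_subcover (fun x => (U x : Set X))
    fun x hx => (U x).isOpen.mem_nhds (hxU x hx)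
  have e : K = t.sup U := by
    refine le_antisymm ?_ (Finset.sup_le fun x hx => hUK x (ht x hx))
    intro x hx
    have := hK hx
    rw [← CompactOpens.coe_finsetSup] at this
    exact this
  rw [e]
  exact Finset.sup_induction hbot (fun a ha b hb => hsup a b ha hb) fun x hx => hPU x (ht x hx)

end CompactOpens

/-! ### Stone duality -/

section PropHom

variable {L : Type u} [DistribLattice L] [BoundedOrder L]

theorem propHom_inf (p : BoundedLatticeHom L Prop) (a b : L) : p (a ⊓ b) ↔ p a ∧ p b := by
  rw [map_inf]
  rfl

theorem propHom_sup (p : BoundedLatticeHom L Prop) (a b : L) : p (a ⊔ b) ↔ p a ∨ p b := by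
  rw [map_sup]
  rfl

theorem propHom_top (p : BoundedLatticeHom L Prop) : p ⊤ := by
  rw [map_top]
  trivial

theorem propHom_bot (p : BoundedLatticeHom L Prop) : ¬ p ⊥ := by
  rw [map_bot]
  exact id

theorem propHom_mono (p : BoundedLatticeHom L Prop) {a b : L} (h : a ≤ b) (ha : p a) : p b := by
  have := (propHom_inf p a b).mp (by rwa [inf_eq_left.mpr h])
  exact this.2

/-- A bounded lattice homomorphism to `Prop`, from its elementary properties. -/
def propHomMk (p : L → Prop) (hinf : ∀ a b, p (a ⊓ b) ↔ p a ∧ p b)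
    (hsup : ∀ a b, p (a ⊔ b) ↔ p a ∨ p b) (htop : p ⊤) (hbot : ¬ p ⊥) :
    BoundedLatticeHom L Prop where
  toFun := p
  map_inf' a b := propext (hinf a b)
  map_sup' a b := propext (hsup a b)
  map_top' := propext (iff_of_true htop trivial)
  map_bot' := propext (iff_of_false hbot id)

/-- The prime ideal theorem, in terms of homomorphisms to `Prop`. -/
theorem exists_propHom (I : Order.Ideal L) {a : L} (ha : a ∉ I) :
    ∃ p : BoundedLatticeHom L Prop, p a ∧ ∀ b ∈ I, ¬ p b := by
  obtain ⟨J, hJ, hIJ, hd⟩ := DistribLattice.prime_ideal_of_disjoint_filter_ideal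
    (F := Order.PFilter.principal a) (I := I) (by
      rw [Set.disjoint_left]
      exact fun b hb hbI => ha (I.lower hb hbI))
  refine ⟨propHomMk (fun b => b ∉ J) (fun b c => ?_) (fun b c => ?_) ?_ ?_, ?_, ?_⟩
  · rw [← not_or, not_iff_not]
    exact ⟨hJ.mem_or_mem, fun h => h.elim (J.lower inf_le_left) (J.lower inf_le_right)⟩
  · rw [← not_and_or, not_iff_not]
    exact Order.Ideal.sup_mem_iff
  · exact fun h => hJ.1.1 (by
      ext b
      exact iff_of_true (J.lower le_top h) trivial)
  · exact fun h => h J.bot_mem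
  · exact fun h => Set.disjoint_left.mp hd (show a ∈ (Order.PFilter.principal a : Set L) from
      Order.PFilter.mem_principal.mpr le_rfl) h
  · exact fun b hb h => h (hIJ hb)

end PropHom

section Points

variable {X : Type u} [TopologicalSpace X] [SpectralSpace X]

/-- The points of a spectral space are the homomorphisms from its lattice of compact open sets
to `Prop`. -/
theorem exists_point (p : BoundedLatticeHom (CompactOpens X) Prop) :
    ∃ x : X, ∀ K : CompactOpens X, x ∈ K ↔ p K := by
  let C : Set X := {x | ∀ K : CompactOpens X, x ∈ K → p K}
  have hmeet : ∀ K : CompactOpens X, p K → ∃ x ∈ C, x ∈ K := by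
    intro K hK
    by_contra! hne
    refine compactOpens_induction (P := fun K => ¬ p K) K (propHom_bot p)
      (fun U V hU hV h => ((propHom_sup p U V).mp h).elim hU hV) (fun x hx => ?_) hK
    have hxC : ¬ ∀ K : CompactOpens X, x ∈ K → p K := fun h => hne x h hx
    push Not at hxC
    obtain ⟨U, hxU, hU⟩ := hxC
    exact ⟨K ⊓ U, inf_le_left, ⟨hx, hxU⟩, fun h => hU ((propHom_inf p K U).mp h).2⟩
  have hclosed : IsClosed C := by
    have : C = ⋂ (K : CompactOpens X) (_ : ¬ p K), (K : Set X)ᶜ := by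
      ext x
      simp only [C, Set.mem_iInter, Set.mem_compl_iff]
      exact ⟨fun h K hK hx => hK (h K hx), fun h K hx => by_contra fun hK => h K hK hx⟩
    rw [this]
    exact isClosed_iInter fun K => isClosed_iInter fun _ => K.isOpen.isClosed_compl
  have hirr : IsIrreducible C := by
    refine ⟨?_, ?_⟩
    · obtain ⟨x, hx, -⟩ := hmeet ⊤ (propHom_top p)
      exact ⟨x, hx⟩
    · rintro U V hU hV ⟨x, hxC, hxU⟩ ⟨y, hyC, hyV⟩
      obtain ⟨K, hxK, hKU⟩ := exists_compactOpens_le (U := ⟨U, hU⟩) hxU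
      obtain ⟨M, hyM, hMV⟩ := exists_compactOpens_le (U := ⟨V, hV⟩) hyV
      obtain ⟨z, hzC, hzK⟩ := hmeet (K ⊓ M) ((propHom_inf p K M).mpr ⟨hxC K hxK, hyC M hyM⟩)
      exact ⟨z, hzC, hKU hzK.1, hMV hzK.2⟩
  obtain ⟨x, hx⟩ := QuasiSober.sober hirr hclosed
  refine ⟨x, fun K => ⟨hx.mem K, fun hK => ?_⟩⟩
  obtain ⟨y, hyC, hyK⟩ := hmeet K hK
  exact hx.specializes hyC |>.mem_open K.isOpen hyK

theorem eq_of_mem_compactOpens {x y : X} (h : ∀ K : CompactOpens X, x ∈ K ↔ y ∈ K) : x = y := by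
  refine PrespectralSpace.isTopologicalBasis.eq_iff.mpr ?_
  rintro U ⟨h₁, h₂⟩
  exact h ⟨⟨U, h₂⟩, h₁⟩

variable {Y : Type u} [TopologicalSpace Y] [SpectralSpace Y]

omit [SpectralSpace X] in
theorem spectralMap_ext {f g : SpectralMap X Y}
    (h : ∀ K : CompactOpens Y, preimageKO f K = preimageKO g K) : f = g := by
  refine SpectralMap.ext fun x => eq_of_mem_compactOpens fun K => ?_
  exact SetLike.ext_iff.mp (h K) x

/-- Every bounded lattice homomorphism between the lattices of compact open sets of spectral
spaces comes from a spectral map. -/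
theorem exists_spectralMap (φ : BoundedLatticeHom (CompactOpens Y) (CompactOpens X)) :
    ∃ f : SpectralMap X Y, ∀ K : CompactOpens Y, preimageKO f K = φ K := by
  have hpt : ∀ x : X, ∃ y : Y, ∀ K : CompactOpens Y, y ∈ K ↔ x ∈ φ K := fun x =>
    exists_point (propHomMk (fun K => x ∈ φ K)
      (fun a b => by rw [map_inf]; rfl) (fun a b => by rw [map_sup]; rfl)
      (by rw [map_top]; trivial) (by rw [map_bot]; exact id))
  choose f hf using hpt
  have hpre : ∀ K : CompactOpens Y, f ⁻¹' (K : Set Y) = φ K := fun K => Set.ext fun x => hf x K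
  refine ⟨⟨f, ⟨?_, ?_⟩⟩, fun K => CompactOpens.ext (hpre K)⟩
  · refine PrespectralSpace.isTopologicalBasis.continuous_iff.mpr ?_
    rintro U ⟨h₁, h₂⟩
    exact hpre ⟨⟨U, h₂⟩, h₁⟩ ▸ (φ _).isOpen
  · intro U h₁ h₂
    exact hpre ⟨⟨U, h₂⟩, h₁⟩ ▸ (φ _).isCompact

end Points

/-- The space of homomorphisms from a bounded distributive lattice to `Prop`. -/
def StoneSpace (L : Type u) [DistribLattice L] [BoundedOrder L] : Type u :=
  BoundedLatticeHom L Prop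

namespace StoneSpace

variable {L : Type u} [DistribLattice L] [BoundedOrder L]

/-- The value of a point of the Stone space, a homomorphism to `Prop`. -/
def hom (p : StoneSpace L) : BoundedLatticeHom L Prop := p

/-- The basic open subset of points containing a given element. -/
def basicSet (a : L) : Set (StoneSpace L) := {p | p.hom a}

instance : TopologicalSpace (StoneSpace L) := generateFrom (Set.range basicSet)

theorem basicSet_inf (a b : L) : basicSet (a ⊓ b) = basicSet a ∩ basicSet b :=
  Set.ext fun p => propHom_inf p.hom a b

theorem basicSet_sup (a b : L) : basicSet (a ⊔ b) = basicSet a ∪ basicSet b :=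
  Set.ext fun p => propHom_sup p.hom a b

theorem basicSet_top : basicSet (⊤ : L) = Set.univ :=
  Set.eq_univ_of_forall fun p => propHom_top p.hom

theorem basicSet_bot : basicSet (⊥ : L) = ∅ :=
  Set.eq_empty_of_forall_notMem fun p => propHom_bot p.hom

theorem isOpen_basicSet (a : L) : IsOpen (basicSet a) :=
  isOpen_generateFrom_of_mem ⟨a, rfl⟩

theorem isTopologicalBasis : IsTopologicalBasis (Set.range (basicSet (L := L))) where
  exists_subset_inter := by
    rintro _ ⟨a, rfl⟩ _ ⟨b, rfl⟩ p hp
    exact ⟨basicSet (a ⊓ b), ⟨_, rfl⟩, by rwa [basicSet_inf], (basicSet_inf a b).le⟩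
  sUnion_eq := Set.eq_univ_of_forall fun p => ⟨_, ⟨⊤, rfl⟩, propHom_top p.hom⟩
  eq_generateFrom := rfl

theorem basicSet_subset {a b : L} : basicSet a ⊆ basicSet b ↔ a ≤ b := by
  refine ⟨fun h => by_contra fun hab => ?_, fun h p hp => propHom_mono p.hom h hp⟩
  obtain ⟨p, ha, hb⟩ := exists_propHom (Order.Ideal.principal b)
    (a := a) (fun h => hab (Order.Ideal.mem_principal.mp h))
  exact hb b (Order.Ideal.mem_principal.mpr le_rfl) (h (show (p : StoneSpace L) ∈ basicSet a from ha))

theorem isCompact_basicSet (a : L) : IsCompact (basicSet a) := by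
  refine isCompact_generateFrom rfl fun P hP hcov => ?_
  classical
  let I : Order.Ideal L :=
    { carrier := {x | ∃ t : Finset L, (∀ b ∈ t, basicSet b ∈ P) ∧ x ≤ t.sup id}
      lower' := fun x y hxy ⟨t, ht, hx⟩ => ⟨t, ht, hxy.trans hx⟩
      nonempty' := ⟨⊥, ∅, by simp, bot_le⟩
      directed' := fun x ⟨t, ht, hx⟩ y ⟨t', ht', hy⟩ =>
        ⟨x ⊔ y, ⟨t ∪ t', fun b hb => (Finset.mem_union.mp hb).elim (ht b) (ht' b), by
          rw [Finset.sup_union]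
          exact sup_le_sup hx hy⟩, le_sup_left, le_sup_right⟩ }
  have ha : a ∈ I := by
    by_contra ha
    obtain ⟨p, hpa, hp⟩ := exists_propHom I ha
    obtain ⟨U, hU, hpU⟩ := hcov (show (p : StoneSpace L) ∈ basicSet a from hpa)
    obtain ⟨b, rfl⟩ := hP hU
    exact hp b ⟨{b}, by simpa using hU, by simp⟩ hpU
  obtain ⟨t, ht, hat⟩ := ha
  refine ⟨basicSet '' (t : Set L), ?_, t.finite_toSet.image _, (basicSet_subset.mpr hat).trans ?_⟩
  · rintro _ ⟨b, hb, rfl⟩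
    exact ht b hb
  · have : ∀ t : Finset L, basicSet (t.sup id) ⊆ ⋃₀ (basicSet '' (t : Set L)) := by
      intro t
      induction t using Finset.induction_on with
      | empty => simp [basicSet_bot]
      | insert b t _ ih =>
        rw [Finset.sup_insert, basicSet_sup, Finset.coe_insert, Set.image_insert_eq,
          Set.sUnion_insert]
        exact Set.union_subset_union le_rfl ih
    exact this t

theorem inseparable_iff {p q : StoneSpace L} : Inseparable p q ↔ ∀ a, p.hom a ↔ q.hom a :=
  isTopologicalBasis.inseparable_iff.trans Set.forall_mem_range

instance : SpectralSpace (StoneSpace L) where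
  t0 p q h := DFunLike.ext p.hom q.hom fun a => propext (inseparable_iff.mp h a)
  isCompact_univ := basicSet_top (L := L) ▸ isCompact_basicSet ⊤
  toQuasiSeparatedSpace := .of_isTopologicalBasis isTopologicalBasis fun a b => by
    rw [← basicSet_inf]
    exact isCompact_basicSet _
  toPrespectralSpace := .of_isTopologicalBasis' isTopologicalBasis isCompact_basicSet
  sober {C} hirr hcl := by
    let p : StoneSpace L := propHomMk (fun a => (C ∩ basicSet a).Nonempty)
      (fun a b => by
        rw [basicSet_inf]
        exact ⟨fun ⟨x, hx⟩ => ⟨⟨x, hx.1, hx.2.1⟩, ⟨x, hx.1, hx.2.2⟩⟩,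
          fun h => hirr.2 _ _ (isOpen_basicSet a) (isOpen_basicSet b) h.1 h.2⟩)
      (fun a b => by rw [basicSet_sup, Set.inter_union_distrib_left, Set.union_nonempty])
      (by rw [basicSet_top, Set.inter_univ]; exact hirr.1)
      (by simp [basicSet_bot])
    refine ⟨p, Set.Subset.antisymm (closure_minimal ?_ hcl) fun x hx => ?_⟩
    · rw [Set.singleton_subset_iff]
      by_contra hp
      obtain ⟨_, ⟨a, rfl⟩, hpa, ha⟩ :=
        isTopologicalBasis.exists_subset_of_mem_open hp hcl.isOpen_compl
      obtain ⟨x, hxC, hxa⟩ : (C ∩ basicSet a).Nonempty := hpa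
      exact ha hxa hxC
    · rw [isTopologicalBasis.mem_closure_iff]
      rintro _ ⟨a, rfl⟩ hxa
      exact ⟨p, ⟨x, hx, hxa⟩, rfl⟩

/-- The compact open set of points containing a given element. -/
def basicOpen (a : L) : CompactOpens (StoneSpace L) :=
  ⟨⟨basicSet a, isCompact_basicSet a⟩, isOpen_basicSet a⟩

theorem basicOpen_surjective : Function.Surjective (basicOpen (L := L)) := by
  intro K
  refine compactOpens_induction (P := fun K => ∃ a : L, basicOpen a = K) K
    ⟨⊥, CompactOpens.ext basicSet_bot⟩ ?_ ?_
  · rintro _ _ ⟨a, rfl⟩ ⟨b, rfl⟩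
    exact ⟨a ⊔ b, CompactOpens.ext (basicSet_sup a b)⟩
  · intro p hp
    obtain ⟨_, ⟨a, rfl⟩, hpa, ha⟩ := isTopologicalBasis.exists_subset_of_mem_open
      (show p ∈ (K : Set _) from hp) K.isOpen
    exact ⟨basicOpen a, ha, hpa, a, rfl⟩

/-- A bounded distributive lattice is the lattice of compact open subsets of its Stone space. -/
noncomputable def orderIso (L : Type u) [DistribLattice L] [BoundedOrder L] :
    L ≃o CompactOpens (StoneSpace L) :=
  { Equiv.ofBijective basicOpen ⟨fun _ _ h =>
      le_antisymm (basicSet_subset.mp h.le) (basicSet_subset.mp h.ge), basicOpen_surjective⟩ with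
    map_rel_iff' := basicSet_subset }

end StoneSpace

/-! ### Right distributive bands -/

section Order

variable {B : Type u} [Band B]

theorem NatLE.preLE {x y : B} (h : NatLE x y) : PreLE x y := by
  rw [PreLE, ← h.2, Band.mul_self]

theorem NatLE.trans {x y z : B} (h : NatLE x y) (k : NatLE y z) : NatLE x z :=
  ⟨by rw [h.1, ← mul_assoc, ← k.1], by
    conv_rhs => rw [h.2]
    rw [mul_assoc, ← k.2, ← h.2]⟩

theorem NatLE.refl (x : B) : NatLE x x :=
  ⟨(Band.mul_self x).symm, (Band.mul_self x).symm⟩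

theorem NatLE.antisymm {x y : B} (h : NatLE x y) (k : NatLE y x) : x = y :=
  h.2.trans k.1.symm

end Order

namespace IsRightDistributive

variable {B : Type u} [Band B] (hB : IsRightDistributive B)
include hB

theorem mul_mul_comm (x y z : B) : x * y * z = y * x * z := by
  have h₁ : x * y * z = z * x * y * z := by
    have := hB.right_regular z (x * y)
    rw [← this]; simp only [mul_assoc]
  have h₂ : y * x * z = z * y * x * z := by
    have := hB.right_regular z (y * x)
    rw [← this]; simp only [mul_assoc]
  rw [h₁, h₂, hB.normal]

theorem natLE_iff {x y : B} : NatLE x y ↔ x = x * y :=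
  ⟨fun h => h.2, fun h => ⟨by
    conv_rhs => rw [h]
    rw [← mul_assoc, hB.right_regular, ← h], h⟩⟩

theorem preLE_iff {x y : B} : PreLE x y ↔ x = y * x := by
  rw [PreLE, hB.right_regular]

theorem mul_natLE (x y : B) : NatLE (x * y) y :=
  hB.natLE_iff.mpr (by rw [mul_assoc, Band.mul_self])

theorem mul_preLE_left (x y : B) : PreLE (x * y) x :=
  hB.preLE_iff.mpr (by rw [← mul_assoc, Band.mul_self])

/-- Elements below a common element are ordered like their classes. -/
theorem natLE_of_preLE {x y z : B} (hx : NatLE x z) (hy : NatLE y z) (h : PreLE x y) :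
    NatLE x y := by
  rw [hB.natLE_iff]
  rw [hB.preLE_iff] at h
  rw [hy.2, ← mul_assoc, hB.mul_mul_comm, ← h, ← hx.2]

end IsRightDistributive

/-! ### Spectral representations of bands -/

/-- A map from a band to the lattice of compact open subsets of a space that identifies the
semilattice reflection of the band with that lattice. -/
structure Representation (B : Type u) [Band B] (X : Type u) [TopologicalSpace X] where
  dom : B → CompactOpens X
  surjective : Function.Surjective dom
  preLE_iff : ∀ {x y}, PreLE x y ↔ dom x ≤ dom y

namespace Representation

variable {B : Type u} [Band B] (hB : IsRightDistributive B) {X : Type u} [TopologicalSpace X]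
  (d : Representation B X)
include hB

omit hB in
theorem dom_mono {x y : B} (h : NatLE x y) : d.dom x ≤ d.dom y := d.preLE_iff.mp h.preLE

theorem natLE_of_dom_le {x y z : B} (hx : NatLE x z) (hy : NatLE y z) (h : d.dom x ≤ d.dom y) :
    NatLE x y :=
  hB.natLE_of_preLE hx hy (d.preLE_iff.mpr h)

theorem eq_of_natLE {x y z : B} (hx : NatLE x z) (hy : NatLE y z) (h : d.dom x = d.dom y) :
    x = y :=
  (d.natLE_of_dom_le hB hx hy h.le).antisymm (d.natLE_of_dom_le hB hy hx h.ge)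

theorem exists_restrict (x : B) {K : CompactOpens X} (h : K ≤ d.dom x) :
    ∃ y, d.dom y = K ∧ NatLE y x := by
  obtain ⟨c, rfl⟩ := d.surjective K
  refine ⟨c * x, le_antisymm (d.preLE_iff.mp (hB.mul_preLE_left c x)) ?_, hB.mul_natLE c x⟩
  refine d.preLE_iff.mp (preLE_of_eq (s := c) (t := c) ?_)
  have := hB.preLE_iff.mp (d.preLE_iff.mpr h)
  rw [mul_assoc, mul_assoc, ← this, Band.mul_self, Band.mul_self]

theorem dom_mul [QuasiSeparatedSpace X] (x y : B) : d.dom (x * y) = d.dom x ⊓ d.dom y := by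
  refine le_antisymm (le_inf (d.preLE_iff.mp (hB.mul_preLE_left x y))
    (d.dom_mono (hB.mul_natLE x y))) ?_
  obtain ⟨c, hc⟩ := d.surjective (d.dom x ⊓ d.dom y)
  have hx := hB.preLE_iff.mp (d.preLE_iff.mpr (hc.le.trans inf_le_left))
  have hy := hB.preLE_iff.mp (d.preLE_iff.mpr (hc.le.trans inf_le_right))
  rw [← hc]
  refine d.preLE_iff.mp (hB.preLE_iff.mpr ?_)
  rw [mul_assoc, ← hy, ← hx]

theorem dom_isSup {x y s : B} (h : IsSup x y s) : d.dom s = d.dom x ⊔ d.dom y := by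
  refine le_antisymm ?_ (sup_le (d.dom_mono h.1) (d.dom_mono h.2.1))
  obtain ⟨t, ht, hts⟩ := d.exists_restrict hB s (sup_le (d.dom_mono h.1) (d.dom_mono h.2.1))
  rw [← ht]
  exact d.dom_mono (h.2.2 t (d.natLE_of_dom_le hB h.1 hts (ht ▸ le_sup_left))
    (d.natLE_of_dom_le hB h.2.1 hts (ht ▸ le_sup_right)))

omit hB in
theorem dom_isZero {o : B} (h : IsZero o) : d.dom o = ⊥ := by
  obtain ⟨b, hb⟩ := d.surjective ⊥
  exact le_bot_iff.mp (hb ▸ d.dom_mono (h b))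

theorem mul_eq_of_natLE [QuasiSeparatedSpace X] {x y z : B} (hzy : NatLE z y)
    (hz : d.dom z = d.dom x ⊓ d.dom y) : x * y = z :=
  d.eq_of_natLE hB (hB.mul_natLE x y) hzy (by rw [d.dom_mul hB, hz])

/-- An element is determined by its restrictions to small compact open sets. -/
theorem eq_of_locally_eq [QuasiSeparatedSpace X] {x y : B} (hd : d.dom x = d.dom y)
    (h : ∀ p ∈ d.dom x, ∃ z, p ∈ d.dom z ∧ NatLE z x ∧ NatLE z y) : x = y := by
  suffices ∃ z, d.dom z = d.dom x ∧ NatLE z x ∧ NatLE z y by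
    obtain ⟨z, hz, hx, hy⟩ := this
    rw [← d.eq_of_natLE hB hx (.refl x) hz, ← d.eq_of_natLE hB hy (.refl y) (hz.trans hd)]
  refine compactOpens_induction (P := fun K => ∃ z, d.dom z = K ∧ NatLE z x ∧ NatLE z y)
    (d.dom x) ?_ ?_ ?_
  · obtain ⟨o, ho⟩ := hB.exists_zero
    exact ⟨o, d.dom_isZero ho, ho x, ho y⟩
  · rintro _ _ ⟨z, rfl, hzx, hzy⟩ ⟨w, rfl, hwx, hwy⟩
    have hc : z * w = w * z := by
      refine d.eq_of_natLE hB ((hB.mul_natLE z w).trans hwx) ((hB.mul_natLE w z).trans hzx) ?_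
      rw [d.dom_mul hB, d.dom_mul hB, inf_comm]
    obtain ⟨s, hs⟩ := hB.exists_sup z w hc
    exact ⟨s, d.dom_isSup hB hs, hs.2.2 x hzx hwx, hs.2.2 y hzy hwy⟩
  · intro p hp
    obtain ⟨z, hpz, hzx, hzy⟩ := h p hp
    exact ⟨d.dom z, d.dom_mono hzx, hpz, z, rfl, hzx, hzy⟩

/-- Locally compatible elements of a band have a common extension. -/
theorem exists_glue [QuasiSeparatedSpace X] (K : CompactOpens X) (S : B → Prop)
    (hcov : ∀ p ∈ K, ∃ x, S x ∧ p ∈ d.dom x ∧ d.dom x ≤ K)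
    (hS : ∀ x y, S x → S y → x * y = y * x) :
    ∃ x, d.dom x = K ∧ ∀ y, S y → d.dom y ≤ K → NatLE y x := by
  have key : K ≤ K → ∃ x, d.dom x = K ∧ ∀ y, S y → x * y = y * x := by
    refine compactOpens_induction
      (P := fun M => M ≤ K → ∃ x, d.dom x = M ∧ ∀ y, S y → x * y = y * x) K ?_ ?_ ?_
    · intro _
      obtain ⟨o, ho⟩ := hB.exists_zero
      exact ⟨o, d.dom_isZero ho, fun y _ => (ho y).2.symm.trans (ho y).1⟩
    · intro M N hM hN hMN
      obtain ⟨x, rfl, hx⟩ := hM (le_sup_left.trans hMN)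
      obtain ⟨y, rfl, hy⟩ := hN (le_sup_right.trans hMN)
      have hxy : x * y = y * x := by
        refine d.eq_of_locally_eq hB (by rw [d.dom_mul hB, d.dom_mul hB, inf_comm]) fun p hp => ?_
        rw [d.dom_mul hB] at hp
        obtain ⟨z, hzS, hpz, -⟩ := hcov p (hMN (Or.inl hp.1))
        refine ⟨z * (x * y), ?_, hB.mul_natLE _ _, ?_⟩
        · rw [d.dom_mul hB, d.dom_mul hB]
          exact ⟨hpz, hp⟩
        · have : z * (x * y) = z * (y * x) := by
            rw [← mul_assoc, ← hx z hzS, mul_assoc, ← hy z hzS, ← mul_assoc, hB.mul_mul_comm,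
              mul_assoc, hx z hzS, ← mul_assoc, hy z hzS, mul_assoc]
          rw [this]
          exact hB.mul_natLE _ _
      obtain ⟨s, hs⟩ := hB.exists_sup x y hxy
      have hloc : ∀ x w, NatLE x s → S w → x * w = w * x → NatLE (x * w) (w * s) := by
        intro x w hxs _ h
        have : x * w = x * (w * s) := by
          rw [← mul_assoc, h, mul_assoc, ← hxs.2]
        rw [this]
        exact hB.mul_natLE _ _
      have hloc' : ∀ x w, NatLE x s → NatLE (x * w) (s * w) := by
        intro x w hxs
        have : x * w = x * (s * w) := by rw [← mul_assoc, ← hxs.2]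
        rw [this]
        exact hB.mul_natLE _ _
      refine ⟨s, d.dom_isSup hB hs, fun w hw => ?_⟩
      refine d.eq_of_locally_eq hB (by rw [d.dom_mul hB, d.dom_mul hB, inf_comm]) fun p hp => ?_
      rw [d.dom_mul hB, d.dom_isSup hB hs] at hp
      rcases hp with ⟨hp | hp, hpw⟩
      · exact ⟨x * w, by rw [d.dom_mul hB]; exact ⟨hp, hpw⟩, hloc' x w hs.1,
          hloc x w hs.1 hw (hx w hw)⟩
      · exact ⟨y * w, by rw [d.dom_mul hB]; exact ⟨hp, hpw⟩, hloc' y w hs.2.1,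
          hloc y w hs.2.1 hw (hy w hw)⟩
    · intro p hp
      obtain ⟨x, hx, hpx, hxK⟩ := hcov p hp
      exact ⟨d.dom x, hxK, hpx, fun _ => ⟨x, rfl, fun y hy => hS x y hx hy⟩⟩
  obtain ⟨x, hx, h⟩ := key le_rfl
  refine ⟨x, hx, fun y hy hyK => hB.natLE_iff.mpr ?_⟩
  rw [← h y hy]
  exact (d.mul_eq_of_natLE hB (.refl y) (by rw [hx, inf_eq_right.mpr hyK])).symm

end Representation

/-! ### The sheaf of a band -/

/-- A section over `U` of the sheaf of a band: a compatible choice of elements of the band over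
the compact open subsets of `U`. -/
@[ext]
structure BandSection {B : Type u} [Band B] {X : Type u} [TopologicalSpace X]
    (d : Representation B X) (U : Opens X) : Type u where
  toFun : ∀ K : CompactOpens X, K.toOpens ≤ U → B
  dom_eq : ∀ K h, d.dom (toFun K h) = K
  mono : ∀ {K M} (hM : M.toOpens ≤ U) (h : K ≤ M),
    NatLE (toFun K ((LocalSection.toOpens_mono h).trans hM)) (toFun M hM)

namespace BandSection

variable {B : Type u} [Band B] {X : Type u} [TopologicalSpace X] {d : Representation B X}

/-- Restriction of sections. -/
def res {U V : Opens X} (h : V ≤ U) (s : BandSection d U) : BandSection d V where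
  toFun K hK := s.toFun K (hK.trans h)
  dom_eq K hK := s.dom_eq K (hK.trans h)
  mono hM k := s.mono (hM.trans h) k

variable (hB : IsRightDistributive B)
include hB

theorem exists_toFun_eq (b : B) :
    ∃ s : BandSection d (d.dom b).toOpens, s.toFun (d.dom b) le_rfl = b := by
  choose f hf using fun (K : CompactOpens X) (h : K.toOpens ≤ (d.dom b).toOpens) =>
    d.exists_restrict hB b h
  exact ⟨⟨f, fun K h => (hf K h).1, fun {K M} hM h => d.natLE_of_dom_le hB (hf K _).2 (hf M hM).2
    (by rwa [(hf K _).1, (hf M hM).1])⟩, d.eq_of_natLE hB (hf _ le_rfl).2 (.refl b) (hf _ le_rfl).1⟩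

theorem eq_of_toFun_eq {K : CompactOpens X} {s t : BandSection d K.toOpens}
    (h : s.toFun K le_rfl = t.toFun K le_rfl) : s = t := by
  ext M hM
  exact d.eq_of_natLE hB (s.mono le_rfl hM) (h ▸ t.mono le_rfl hM)
    ((s.dom_eq M hM).trans (t.dom_eq M hM).symm)

theorem mul_toFun [QuasiSeparatedSpace X] {U V : Opens X} (s : BandSection d U)
    (t : BandSection d V) {K M : CompactOpens X} (hK : K.toOpens ≤ U) (hM : M.toOpens ≤ V) :
    s.toFun K hK * t.toFun M hM =
      t.toFun (K ⊓ M) ((LocalSection.toOpens_mono inf_le_right).trans hM) :=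
  d.mul_eq_of_natLE hB (t.mono hM inf_le_right) (by simp only [dom_eq])

theorem existsUnique_glue [PrespectralSpace X] [QuasiSeparatedSpace X] {ι : Type*} (U : ι → Opens X)
    (sf : ∀ i, BandSection d (U i))
    (hsf : ∀ i j, (sf i).res (inf_le_left : U i ⊓ U j ≤ U i) = (sf j).res inf_le_right) :
    ∃! s : BandSection d (iSup U), ∀ i, s.res (le_iSup U i) = sf i := by
  have hcompat : ∀ i j K (hi : K.toOpens ≤ U i) (hj : K.toOpens ≤ U j),
      (sf i).toFun K hi = (sf j).toFun K hj := fun i j K hi hj =>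
    congrArg (fun s => s.toFun K (le_inf hi hj)) (hsf i j)
  let S : B → Prop := fun y => ∃ i K h, y = (sf i).toFun K h
  have hcomm : ∀ x y, S x → S y → x * y = y * x := by
    rintro _ _ ⟨i, K, hK, rfl⟩ ⟨j, M, hM, rfl⟩
    rw [mul_toFun hB, mul_toFun hB, hcompat j i (K ⊓ M)
      ((LocalSection.toOpens_mono inf_le_right).trans hM)
      ((LocalSection.toOpens_mono inf_le_left).trans hK)]
    simp only [inf_comm]
  have hcov : ∀ K : CompactOpens X, K.toOpens ≤ iSup U → ∀ p ∈ K,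
      ∃ i M, ∃ h : M.toOpens ≤ U i, p ∈ M ∧ M ≤ K := by
    intro K hK p hp
    obtain ⟨i, hi⟩ := Opens.mem_iSup.mp (hK hp)
    obtain ⟨M, hpM, hM⟩ := exists_compactOpens_le (U := U i ⊓ K.toOpens) ⟨hi, hp⟩
    exact ⟨i, M, hM.trans inf_le_left, hpM, hM.trans inf_le_right⟩
  choose G hG hle using fun (K : CompactOpens X) (hK : K.toOpens ≤ iSup U) =>
    d.exists_glue hB K S (fun p hp => by
      obtain ⟨i, M, h, hpM, hMK⟩ := hcov K hK p hp
      exact ⟨(sf i).toFun M h, ⟨i, M, h, rfl⟩, ((sf i).dom_eq M h).symm ▸ hpM,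
        ((sf i).dom_eq M h).symm ▸ hMK⟩) hcomm
  have hle' : ∀ K hK i M (h : M.toOpens ≤ U i), M ≤ K → NatLE ((sf i).toFun M h) (G K hK) :=
    fun K hK i M h hMK => hle K hK _ ⟨i, M, h, rfl⟩ (((sf i).dom_eq M h).symm ▸ hMK)
  have huniq : ∀ K hK x, d.dom x = K →
      (∀ i M (h : M.toOpens ≤ U i), M ≤ K → NatLE ((sf i).toFun M h) x) → x = G K hK := by
    intro K hK x hx h
    refine d.eq_of_locally_eq hB (hx.trans (hG K hK).symm) fun p hp => ?_
    obtain ⟨i, M, hM, hpM, hMK⟩ := hcov K hK p (hx ▸ hp)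
    exact ⟨(sf i).toFun M hM, ((sf i).dom_eq M hM).symm ▸ hpM, h i M hM hMK,
      hle' K hK i M hM hMK⟩
  refine ⟨⟨G, hG, fun {K M} hM hKM => ?_⟩, fun i => ?_, fun t ht => ?_⟩
  · obtain ⟨x, hx, hxM⟩ := d.exists_restrict hB (G M hM) (K := K) ((hG M hM).symm ▸ hKM)
    rw [← huniq K _ x hx fun i N hN hNK => d.natLE_of_dom_le hB
      (hle' M hM i N hN (hNK.trans hKM)) hxM (by rwa [(sf i).dom_eq, hx])]
    exact hxM
  · ext K hK
    exact (huniq K _ _ ((sf i).dom_eq K hK) fun j M hM hMK => by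
      rw [hcompat j i M hM ((LocalSection.toOpens_mono hMK).trans hK)]
      exact (sf i).mono hK hMK).symm
  · ext K hK
    refine huniq K hK _ (t.dom_eq K hK) fun i M hM hMK => ?_
    rw [← ht i]
    exact t.mono hK hMK

end BandSection

section Sheaf

variable {B : Type u} [Band B] (hB : IsRightDistributive B) {X : SpectralTop.{u}}
  (d : Representation B X.carrier)

/-- The presheaf of a band. -/
def bandPresheaf : TopCat.Presheaf (Type u) (TopCat.of X.carrier) where
  obj U := BandSection (X := X.carrier) d U.unop
  map f := TypeCat.ofHom (BandSection.res f.unop.le)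

/-- The global spectral sheaf of a right distributive band. -/
def bandSheaf : GlobalSpectralSheaf.{u} where
  space := X
  sheaf := ⟨bandPresheaf d, TopCat.Presheaf.isSheaf_of_isSheafUniqueGluing_types _
    fun _ U sf h => BandSection.existsUnique_glue hB U sf h⟩
  exists_global := by
    obtain ⟨b, hb⟩ := d.surjective ⊤
    obtain ⟨s, -⟩ := BandSection.exists_toFun_eq (d := d) hB b
    exact ⟨s.res (hb.ge : ⊤ ≤ d.dom b)⟩

/-- A right distributive band is the band of local sections of its sheaf. -/
noncomputable def bandSheafMulEquiv : LocalSection (bandSheaf hB d) ≃* B :=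
  MulEquiv.ofBijective
    (MulHom.mk (fun a : LocalSection (bandSheaf hB d) =>
        BandSection.toFun (d := d) (U := a.dom.toOpens) a.val a.dom le_rfl)
      fun a b => (BandSection.mul_toFun hB (d := d) (U := a.dom.toOpens) (V := b.dom.toOpens)
        a.val b.val le_rfl le_rfl).symm) <| by
    constructor
    · rintro ⟨K, s⟩ ⟨M, t⟩ h
      obtain rfl : K = M := by
        have := congrArg d.dom h
        exact (BandSection.dom_eq (d := d) (U := K.toOpens) s K le_rfl).symm.trans
          (this.trans (BandSection.dom_eq (d := d) (U := M.toOpens) t M le_rfl))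
      exact congrArg (LocalSection.mk K) (BandSection.eq_of_toFun_eq (d := d) hB h)
    · intro b
      obtain ⟨s, hs⟩ := BandSection.exists_toFun_eq (d := d) hB b
      exact ⟨⟨d.dom b, s⟩, hs⟩

end Sheaf

/-! ### Essential surjectivity -/

theorem isGlobal_iff_forall {B : Type u} [Band B] {x : B} : IsGlobal x ↔ ∀ y : B, PreLE y x :=
  ⟨fun h y => h (toReflection y), fun h => by
    rintro ⟨y⟩
    exact h y⟩

section MulEquiv

variable {B C : Type u} [Band B] [Band C] (e : B ≃* C)

theorem natLE_mulEquiv {x y : B} : NatLE (e x) (e y) ↔ NatLE x y := by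
  simp only [NatLE, ← map_mul, e.injective.eq_iff]

theorem preLE_mulEquiv {x y : B} : PreLE (e x) (e y) ↔ PreLE x y := by
  simp only [PreLE, ← map_mul, e.injective.eq_iff]

end MulEquiv

/-- A multiplicative isomorphism of right distributive bands is a map of such bands. -/
def RightDistBand.homOfMulEquiv {X Y : RightDistBand.{u}} (e : X.carrier ≃* Y.carrier) : X ⟶ Y where
  toFun := e
  map_mul := map_mul e
  map_zero _ h := e.surjective.forall.mpr fun x => (natLE_mulEquiv e).mpr (h x)
  map_global _ h := isGlobal_iff_forall.mpr <| e.surjective.forall.mpr fun y =>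
    (preLE_mulEquiv e).mpr (isGlobal_iff_forall.mp h y)
  map_sup _ _ _ _ h := ⟨(natLE_mulEquiv e).mpr h.1, (natLE_mulEquiv e).mpr h.2.1,
    e.surjective.forall.mpr fun t hx hy => (natLE_mulEquiv e).mpr
      (h.2.2 t ((natLE_mulEquiv e).mp hx) ((natLE_mulEquiv e).mp hy))⟩

/-- A multiplicative isomorphism of right distributive bands is an isomorphism. -/
def RightDistBand.isoOfMulEquiv {X Y : RightDistBand.{u}} (e : X.carrier ≃* Y.carrier) :
    X ≅ Y where
  hom := homOfMulEquiv e
  inv := homOfMulEquiv e.symm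
  hom_inv_id := RightDistBand.Hom.ext (funext e.symm_apply_apply)
  inv_hom_id := RightDistBand.Hom.ext (funext e.apply_symm_apply)

theorem exists_representation {B : Type u} [Band B] (hB : IsRightDistributive B) :
    ∃ X : SpectralTop.{u}, Nonempty (Representation B X.carrier) := by
  obtain ⟨L, _, _, ⟨e⟩⟩ := hB.reflection
  let e' := e.trans (StoneSpace.orderIso L)
  refine ⟨⟨StoneSpace L⟩, ⟨⟨fun b => e' (toReflection b), fun K => ?_, fun {x y} => ?_⟩⟩⟩
  · obtain ⟨⟨b⟩, hb⟩ := e'.surjective K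
    exact ⟨b, hb⟩
  · rw [e'.le_iff_le, toReflection_le]

instance : localSectionBand.{u}.EssSurj where
  mem_essImage B := by
    obtain ⟨X, ⟨d⟩⟩ := exists_representation B.isRightDistributive
    exact ⟨op (bandSheaf B.isRightDistributive d),
      ⟨RightDistBand.isoOfMulEquiv (bandSheafMulEquiv B.isRightDistributive d)⟩⟩

instance : KO.{u}.EssSurj where
  mem_essImage L := ⟨op ⟨StoneSpace L⟩, ⟨(BddDistLat.Iso.mk (StoneSpace.orderIso L)).symm⟩⟩

/-! ### Full faithfulness -/

section Sections

variable {F : GlobalSpectralSheaf.{u}} {Y : Type u} [TopologicalSpace Y] [SpectralSpace Y]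
  (f : SpectralMap F.space.carrier Y) {U : Opens Y}

theorem le_iSup_preimage : preimage f U ≤
    ⨆ K : {K : CompactOpens Y // K.toOpens ≤ U}, preimage f K.1.toOpens := by
  intro x hx
  obtain ⟨K, hxK, hK⟩ := exists_compactOpens_le (U := U) (x := f x) hx
  exact Opens.mem_iSup.mpr ⟨⟨K, hK⟩, hxK⟩

theorem sections_ext {s t : F.Sections (preimage f U)}
    (h : ∀ (K : CompactOpens Y) (hK : K.toOpens ≤ U),
      F.res (preimage_mono f hK) s = F.res (preimage_mono f hK) t) : s = t :=
  F.sheaf.eq_of_locally_eq' (fun K : {K : CompactOpens Y // K.toOpens ≤ U} =>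
    preimage f K.1.toOpens) (preimage f U) (fun K => homOfLE (preimage_mono f K.2))
    (le_iSup_preimage f) s t fun K => h K.1 K.2

theorem exists_sections_glue
    (ψ : ∀ K : CompactOpens Y, K.toOpens ≤ U → F.Sections (preimage f K.toOpens))
    (hψ : ∀ (K M : CompactOpens Y) (h : K.toOpens ≤ M.toOpens) (hM : M.toOpens ≤ U),
      F.res (preimage_mono f h) (ψ M hM) = ψ K (h.trans hM)) :
    ∃ s : F.Sections (preimage f U), ∀ (K : CompactOpens Y) (hK : K.toOpens ≤ U),
      F.res (preimage_mono f hK) s = ψ K hK := by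
  obtain ⟨s, hs, -⟩ := F.sheaf.existsUnique_gluing'
    (fun K : {K : CompactOpens Y // K.toOpens ≤ U} => preimage f K.1.toOpens) (preimage f U)
    (fun K => homOfLE (preimage_mono f K.2)) (le_iSup_preimage f) (fun K => ψ K.1 K.2) (by
      rintro ⟨K, hK⟩ ⟨M, hM⟩
      have hle : preimage f K.toOpens ⊓ preimage f M.toOpens ≤ preimage f (K ⊓ M).toOpens :=
        fun _ hx => hx
      have h₁ := congrArg (F.res hle) (hψ (K ⊓ M) K (LocalSection.toOpens_mono inf_le_left) hK)
      have h₂ := congrArg (F.res hle) (hψ (K ⊓ M) M (LocalSection.toOpens_mono inf_le_right) hM)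
      rw [F.res_res] at h₁ h₂
      exact h₁.trans h₂.symm)
  exact ⟨s, fun K hK => hs ⟨K, hK⟩⟩

end Sections

namespace LocalSection

variable {F G : GlobalSpectralSheaf.{u}}

/-- A map of global spectral sheaves is determined by its action on local sections. -/
theorem hom_ext {f g : F ⟶ G} (h : ∀ a : LocalSection G, a.map f = a.map g) : f = g := by
  have hbase : f.base = g.base := spectralMap_ext fun K => by
    obtain ⟨a, rfl⟩ := exists_dom K
    exact congrArg dom (h a)
  obtain ⟨f, φ, hφ⟩ := f
  obtain ⟨g, χ, hχ⟩ := g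
  obtain rfl : f = g := hbase
  have : φ = χ := by
    funext U s
    refine sections_ext f fun K hK => ?_
    rw [← hφ hK, ← hχ hK]
    exact eq_of_heq (LocalSection.mk.inj (h ⟨K, G.res hK s⟩)).2
  subst this
  rfl

theorem natLE_apply {φ : LocalSection G → LocalSection F} (hmul : ∀ a b, φ (a * b) = φ a * φ b)
    {a b : LocalSection G} (h : NatLE a b) : NatLE (φ a) (φ b) :=
  ⟨(congrArg φ h.1).trans (hmul b a), (congrArg φ h.2).trans (hmul a b)⟩

/-- A map between bands of local sections induces a homomorphism of lattices of compact open
sets. -/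
theorem exists_latticeHom (φ : localSectionBand.obj (op G) ⟶ localSectionBand.obj (op F)) :
    ∃ χ : BoundedLatticeHom (CompactOpens G.space.carrier) (CompactOpens F.space.carrier),
      ∀ a : LocalSection G, (φ.toFun a : LocalSection F).dom = χ a.dom := by
  let ψ : LocalSection G → LocalSection F := φ.toFun
  have hmul : ∀ a b, ψ (a * b) = ψ a * ψ b := φ.map_mul
  have hmono : ∀ a b : LocalSection G, a.dom ≤ b.dom → (ψ a).dom ≤ (ψ b).dom := by
    intro a b h
    refine preLE_iff.mp ?_
    rw [PreLE, ← hmul, ← hmul, ← preLE_iff.mpr h]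
  choose σ hσ using exists_dom (F := G)
  have hdom : ∀ a b : LocalSection G, a.dom = b.dom → (ψ a).dom = (ψ b).dom := fun a b h =>
    le_antisymm (hmono a b h.le) (hmono b a h.ge)
  refine ⟨
    { toFun := fun K => (ψ (σ K)).dom
      map_sup' := fun K M => ?_
      map_inf' := fun K M => ?_
      map_top' := ?_
      map_bot' := ?_ }, fun a => hdom _ _ (hσ a.dom).symm⟩
  · let t := σ (K ⊔ M)
    have hK : K ≤ t.dom := le_sup_left.trans (hσ (K ⊔ M)).ge
    have hM : M ≤ t.dom := le_sup_right.trans (hσ (K ⊔ M)).ge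
    have h₁ : NatLE (t.restrict K hK) t := natLE_iff.mpr ⟨hK, rfl⟩
    have h₂ : NatLE (t.restrict M hM) t := natLE_iff.mpr ⟨hM, rfl⟩
    have hc : t.restrict K hK * t.restrict M hM = t.restrict M hM * t.restrict K hK :=
      (restrict_restrict t hM inf_le_right).trans ((restrict_congr t (inf_comm K M) _).trans
        (restrict_restrict t hK inf_le_right).symm)
    have hs := φ.map_sup _ _ _ hc (isSup_of_dom (hσ (K ⊔ M)) h₁ h₂)
    have hc' : ψ (t.restrict K hK) * ψ (t.restrict M hM) =
        ψ (t.restrict M hM) * ψ (t.restrict K hK) := by rw [← hmul, hc, hmul]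
    refine ((isSup_iff hc').mp hs).1.trans ?_
    rw [hdom (t.restrict K hK) (σ K) (hσ K).symm, hdom (t.restrict M hM) (σ M) (hσ M).symm]
  · rw [hdom (σ (K ⊓ M)) (σ K * σ M) (by rw [dom_mul, hσ, hσ, hσ]), hmul, dom_mul]
  · exact isGlobal_iff.mp (φ.map_global _ (isGlobal_iff.mpr (hσ ⊤)))
  · exact isZero_iff.mp (φ.map_zero _ (isZero_iff.mpr (hσ ⊥)))

theorem ext_restrict {a b : LocalSection F} (h : a.dom = b.dom)
    (hval : F.res (toOpens_mono h.le) b.val = a.val) : a = b := by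
  obtain ⟨K, s⟩ := a
  obtain ⟨M, t⟩ := b
  obtain rfl : K = M := h
  exact congrArg (LocalSection.mk K) (hval.symm.trans (F.res_self _ t))

/-- Every map between bands of local sections comes from a map of global spectral sheaves. -/
theorem exists_hom (φ : localSectionBand.obj (op G) ⟶ localSectionBand.obj (op F)) :
    ∃ f : F ⟶ G, ∀ a : LocalSection G, a.map f = φ.toFun a := by
  obtain ⟨χ, hχ⟩ := exists_latticeHom φ
  obtain ⟨f, hf⟩ := exists_spectralMap χ
  let ψ : LocalSection G → LocalSection F := φ.toFun
  have hdom : ∀ a : LocalSection G, preimageKO f a.dom = (ψ a).dom := fun a =>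
    (hf a.dom).trans (hχ a).symm
  let v : ∀ K : CompactOpens G.space.carrier, G.Sections K.toOpens →
      F.Sections (preimage f K.toOpens) := fun K s =>
    F.res (toOpens_mono (hdom ⟨K, s⟩).le) (ψ ⟨K, s⟩).val
  have hv : ∀ (K M : CompactOpens G.space.carrier) (h : K.toOpens ≤ M.toOpens)
      (s : G.Sections M.toOpens), F.res (preimage_mono f h) (v M s) = v K (G.res h s) := by
    intro K M h s
    obtain ⟨h', e⟩ := natLE_iff.mp (natLE_apply (φ := ψ) φ.map_mul
      (natLE_iff.mpr ⟨h, rfl⟩ : NatLE (⟨K, G.res h s⟩ : LocalSection G) ⟨M, s⟩))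
    have key : ∀ (a b : LocalSection F) (N : CompactOpens F.space.carrier) (hN : N = b.dom)
        (h₁ : b.dom ≤ a.dom) (_ : b = a.restrict b.dom h₁) (h₂ : N ≤ a.dom),
        F.res (toOpens_mono h₂) a.val = F.res (toOpens_mono hN.le) b.val := by
      rintro a ⟨N, s⟩ N' hN h₁ e h₂
      obtain rfl : N' = N := hN
      exact (eq_of_heq (LocalSection.mk.inj e).2).symm.trans (F.res_self _ s).symm
    exact (F.res_res _ _ _).trans (key (ψ ⟨M, s⟩) (ψ ⟨K, G.res h s⟩) (preimageKO f K)
      (hdom ⟨K, G.res h s⟩) h' e ((hdom ⟨K, G.res h s⟩).le.trans h'))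
  choose app happ using fun (U : Opens G.space.carrier) (s : G.Sections U) =>
    exists_sections_glue (F := F) f (U := U) (fun K hK => v K (G.res hK s)) (by
      intro K M h hM
      rw [hv K M h, G.res_res])
  refine ⟨⟨f, app, fun {U V} h s => sections_ext f fun K hK => ?_⟩, ?_⟩
  · rw [happ V _ K hK, F.res_res, G.res_res]
    exact (happ U s K (hK.trans h)).symm
  · rintro ⟨K, s⟩
    refine ext_restrict (hdom ⟨K, s⟩) ?_
    have := happ K.toOpens s K le_rfl
    rw [F.res_self, G.res_self] at this
    exact this.symm

end LocalSection

instance : localSectionBand.{u}.Faithful where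
  map_injective h := Quiver.Hom.unop_inj <| LocalSection.hom_ext fun a =>
    congrFun (congrArg RightDistBand.Hom.toFun h) a

instance : localSectionBand.{u}.Full where
  map_surjective φ := by
    obtain ⟨f, hf⟩ := LocalSection.exists_hom φ
    exact ⟨f.op, RightDistBand.Hom.ext (funext hf)⟩

instance : KO.{u}.Faithful where
  map_injective h := Quiver.Hom.unop_inj <| spectralMap_ext fun K =>
    ConcreteCategory.congr_hom h K

instance : KO.{u}.Full where
  map_surjective φ := by
    obtain ⟨f, hf⟩ := exists_spectralMap φ.hom
    exact ⟨Quiver.Hom.op (V := SpectralTop.{u}) f, BddDistLat.hom_ext (DFunLike.ext _ _ hf)⟩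

instance : terminalSheaf.{u}.Faithful where
  map_injective h := congrArg GlobalSpectralSheaf.Hom.base h

instance : terminalSheaf.{u}.Full where
  map_surjective f := ⟨f.base, rfl⟩

instance : latticeBand.{u}.Faithful where
  map_injective h := BddDistLat.hom_ext <| DFunLike.ext _ _ fun a =>
    congrArg MeetBand.val (congrFun (congrArg RightDistBand.Hom.toFun h) ⟨a⟩)

instance : latticeBand.{u}.Full where
  map_surjective {L M} φ := by
    let ψ : MeetBand L → MeetBand M := φ.toFun
    refine ⟨BddDistLat.ofHom
      { toFun := fun a => (ψ ⟨a⟩).val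
        map_sup' := fun a b => MeetBand.isSup_iff.mp
          (φ.map_sup ⟨a⟩ ⟨b⟩ ⟨a ⊔ b⟩ (congrArg MeetBand.mk (inf_comm a b))
            (MeetBand.isSup_iff.mpr rfl))
        map_inf' := fun a b => congrArg MeetBand.val (φ.map_mul ⟨a⟩ ⟨b⟩)
        map_top' := MeetBand.isGlobal_iff.mp (φ.map_global ⟨⊤⟩ (MeetBand.isGlobal_iff.mpr rfl))
        map_bot' := MeetBand.isZero_iff.mp (φ.map_zero ⟨⊥⟩ (MeetBand.isZero_iff.mpr rfl)) }, rfl⟩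

/-- The band of local sections of a terminal sheaf is the lattice of compact open sets. -/
def terminalSheafMulEquiv (X : SpectralTop.{u}) :
    LocalSection (terminalSheaf.obj X) ≃* MeetBand (CompactOpens X.carrier) where
  toFun a := ⟨a.dom⟩
  invFun K := ⟨K.val, PUnit.unit⟩
  left_inv _ := rfl
  right_inv _ := rfl
  map_mul' _ _ := rfl

/-- The duality for global spectral sheaves restricts to Stone duality. -/
def terminalSheafIso : terminalSheaf.{u}.op ⋙ localSectionBand.{u} ≅ KO.{u} ⋙ latticeBand.{u} :=
  NatIso.ofComponents
    (fun X => RightDistBand.isoOfMulEquiv (terminalSheafMulEquiv X.unop)) fun _ => rfl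

end BandDuality

theorem theorem3 :
    BandDuality.localSectionBand.{u}.IsEquivalence ∧
    BandDuality.KO.{u}.IsEquivalence ∧
    (BandDuality.terminalSheaf.{u}.Full ∧ BandDuality.terminalSheaf.{u}.Faithful) ∧
    (BandDuality.latticeBand.{u}.Full ∧ BandDuality.latticeBand.{u}.Faithful) ∧
    Nonempty (BandDuality.terminalSheaf.{u}.op ⋙ BandDuality.localSectionBand.{u} ≅
      BandDuality.KO.{u} ⋙ BandDuality.latticeBand.{u}) :=
  ⟨{}, {}, ⟨inferInstance, inferInstance⟩, ⟨inferInstance, inferInstance⟩,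
    ⟨BandDuality.terminalSheafIso⟩⟩
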